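/- Let $G=(V,E)$ be a finite two-colorable (bipartite) simple graph with partitions $P_1,P_2$, and let $|G\rangle=\prod_{\{u,v\}\in E}CZ_{uv}\,|+\rangle^{\otimes V}$ be its graph state, with one qubit held at each vertex. A vertex $v\in P_i$ is a star vertex if its neighborhood is the whole opposite partition $V\setminus P_i$. For $v\in P_i$, the opposite remote set $\overline N(v)$ is the set of vertices of the opposite partition that are not adjacent to $v$, and $\overline N_\cap(B)=\bigcap_{v\in B}\overline N(v)$ for a set $B$ of vertices in one partition. Assume that each of $P_1$ and $P_2$ contains at least one star vertex. Let $n\ge 1$ and let $B_g$ be a set of non-star vertices in one partition such that $$\bigl|\overline N(v)\setminus\overline N_\cap(B_g)\bigr|\ge n-1\quad\text{for all }v\in B_g,$$ $$\bigl(\overline N(v)\setminus\overline N_\cap(B_g)\bigr)\cap\bigl(\overline N(w)\setminus\overline N_\cap(B_g)\bigr)=\emptyset\quad\text{for all distinct }v,w\in B_g.$$ Then $|B_g|$ remote $n$-qubit GHZ states can be concurrently extracted from $|G\rangle$. That is, there are $|B_g|$ pairwise disjoint sets of $n$ vertices, each of them independent in $G$, and an adaptive protocol consisting of single-qubit Clifford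 operations, single-qubit Pauli measurements and classical communication which, for every sequence of measurement outcomes of nonzero probability, transforms $|G\rangle$ (up to normalization and global phase) into the tensor product of the GHZ states $(|0\cdots0\rangle+|1\cdots1\rangle)/\sqrt2$ on these sets and some state of the remaining qubits. -/

import Mathlib

noncomputable section

namespace RemoteGHZ

/-! ### Two-colorable graphs, star vertices, opposite remote sets

A two-colorable graph with its bipartition is a graph `G` with a proper coloring `C` by `Fin 2`;
the two partitions are the color classes. -/

section Graph

variable {V : Type*} [Fintype V] [DecidableEq V] {G : SimpleGraph V} [DecidableRel G.Adj]

/-- The partition of color `i`. -/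
def part (C : G.Coloring (Fin 2)) (i : Fin 2) : Finset V :=
  {v | C v = i}

/-- The star vertices in the partition of color `i`: their neighborhood is the complement of that
partition, that is, the whole opposite partition. -/
def starVertices (C : G.Coloring (Fin 2)) (i : Fin 2) : Finset V :=
  {v ∈ part C i | G.neighborFinset v = (part C i)ᶜ}

/-- The remaining (non-star) vertices in the partition of color `i`. -/
def nonStarVertices (C : G.Coloring (Fin 2)) (i : Fin 2) : Finset V :=
  part C i \ starVertices C i

/-- The opposite remote set of `v`: the vertices of the other partition not adjacent to `v`. -/
def oppRemote (C : G.Coloring (Fin 2)) (v : V) : Finset V :=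
  {w | C w ≠ C v ∧ ¬ G.Adj v w}

/-- The common intersection of the opposite remote sets of the vertices in `B`. -/
def commonOppRemote (C : G.Coloring (Fin 2)) (B : Finset V) : Finset V :=
  {w | ∀ v ∈ B, w ∈ oppRemote C v}

end Graph

/-! ### Qubit states -/

/-- State vectors (not necessarily normalized) of qubits labelled by `ι`: the amplitude of each
computational basis state. -/
abbrev QState (ι : Type*) : Type _ := (ι → Fin 2) → ℂ

/-- The graph state of `G`: controlled-`Z` along every edge, applied to `|+⟩` on every vertex.
The amplitude of `x` gets one sign for each edge both of whose endpoints have value `1`. -/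
def graphState {V : Type*} [Fintype V] [DecidableEq V] (G : SimpleGraph V) [DecidableRel G.Adj] :
    QState V :=
  fun x => ((1 / √2 : ℝ) : ℂ) ^ Fintype.card V *
    ∏ e ∈ G.edgeFinset, if ∀ v ∈ e, x v = 1 then -1 else 1

/-- The GHZ state `(|0…0⟩ + |1…1⟩)/√2` of the qubits `ι`. -/
def ghzState (ι : Type*) [Fintype ι] : QState ι :=
  fun y => ((1 / √2 : ℝ) : ℂ) *
    ((if ∀ v, y v = 0 then 1 else 0) + (if ∀ v, y v = 1 then 1 else 0))

/-- `ψ` is a tensor product of GHZ states, one on each of the qubit sets `S k`, with some state `φ`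
of the remaining qubits (`φ` also absorbs normalization and global phase). -/
def IsGHZProduct {V : Type*} {r : ℕ} (S : Fin r → Finset V) (ψ : QState V) : Prop :=
  ∃ φ : QState {v : V // ∀ k, v ∉ S k}, φ ≠ 0 ∧
    ∀ x, ψ x = (∏ k, ghzState (S k) fun v => x v) * φ fun v => x v

/-! ### Single-qubit Clifford operations, single-qubit Pauli measurements, and classical
communication -/

/-- Labels of the three Pauli observables. -/
inductive Pauli : Type
  | X
  | Y
  | Z

/-- The Pauli matrices. -/
def Pauli.toMatrix : Pauli → Matrix (Fin 2) (Fin 2) ℂ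
  | .X => !![0, 1; 1, 0]
  | .Y => !![0, -Complex.I; Complex.I, 0]
  | .Z => !![1, 0; 0, -1]

/-- Single-qubit Clifford unitaries: conjugation maps each Pauli matrix to a Pauli matrix up to
sign. -/
def IsClifford (U : Matrix (Fin 2) (Fin 2) ℂ) : Prop :=
  U ∈ Matrix.unitaryGroup (Fin 2) ℂ ∧
    ∀ P : Pauli, ∃ Q : Pauli,
      U * P.toMatrix * U.conjTranspose = Q.toMatrix ∨
        U * P.toMatrix * U.conjTranspose = -Q.toMatrix

/-- The operator `A` acting on qubit `v` (and the identity on all others). -/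
def applyAt {V : Type*} [DecidableEq V] (v : V) (A : Matrix (Fin 2) (Fin 2) ℂ) (ψ : QState V) :
    QState V :=
  fun x => ∑ b : Fin 2, A (x v) b * ψ (Function.update x v b)

/-- The projection onto the eigenspace of the Pauli matrix `P` with eigenvalue `(-1) ^ s`. -/
def Pauli.proj (P : Pauli) (s : Fin 2) : Matrix (Fin 2) (Fin 2) ℂ :=
  (1 / 2 : ℂ) • (1 + (-1 : ℂ) ^ (s : ℕ) • P.toMatrix)

/-- Protocols of single-qubit Clifford operations, single-qubit Pauli measurements and classical
communication: after a measurement, everything that follows (at any node) may depend on the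
outcome. -/
inductive LocalProtocol (V : Type*) : Type _
  | halt : LocalProtocol V
  | clifford (v : V) (U : Matrix (Fin 2) (Fin 2) ℂ) (hU : IsClifford U)
      (next : LocalProtocol V) : LocalProtocol V
  | measure (v : V) (P : Pauli) (next : Fin 2 → LocalProtocol V) : LocalProtocol V

/-- The (unnormalized) final states that a protocol can produce from the state `ψ`, over all
measurement records of nonzero probability. -/
def LocalProtocol.outputs {V : Type*} [DecidableEq V] :
    LocalProtocol V → QState V → Set (QState V)
  | .halt, ψ => {ψ}
  | .clifford v U _ next, ψ => next.outputs (applyAt v U ψ)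
  | .measure v P next, ψ =>
      {χ | ∃ s : Fin 2, applyAt v (P.proj s) ψ ≠ 0 ∧
        χ ∈ (next s).outputs (applyAt v (P.proj s) ψ)}

/-- `r` GHZ states of `n` qubits each can be concurrently extracted among remote subnets of the
graph state of `G`: there are `r` pairwise disjoint independent sets of `n` vertices of `G` and a
protocol that, whatever the measurement outcomes, turns the graph state into GHZ states on
these sets (in tensor product with a state of the other qubits). -/
def RemoteExtractable {V : Type*} [Fintype V] [DecidableEq V] (G : SimpleGraph V)
    [DecidableRel G.Adj] (n r : ℕ) : Prop :=
  ∃ S : Fin r → Finset V,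
    (∀ k, (S k).card = n) ∧
    (∀ k, G.IsIndepSet (S k : Set V)) ∧
    (∀ k l, k ≠ l → Disjoint (S k) (S l)) ∧
    ∃ p : LocalProtocol V, ∀ ψ ∈ p.outputs (graphState G), IsGHZProduct S ψ

end RemoteGHZ

end

/-!
The two star vertices `a`, `b`, one in each partition, do all the work. Measuring both in the
`X` basis is a pivot on the edge `ab`: since `a` and `b` are adjacent to the whole opposite partition,
it complements all edges between the two partitions, up to `Z` phases
(`pivot_graphState`, by the Gauss sum `pivot_sum`). In the bipartite complement a vertex `v` of
`B` is adjacent exactly to its opposite remote set, and the private parts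
`oppRemote C v \ commonOppRemote C B` are disjoint. Choose `n - 1` leaves for each `v ∈ B` in its
private part and measure every qubit other than the centres `v` and their leaves in the `Z` basis.
This leaves disjoint stars, up to `Z` phases on single qubits (`phaseEquiv_stars`), which are
corrected; Hadamard gates on the leaves then turn each star graph state into a GHZ state
(`CanReach.of_hadamard`, `isGHZProduct_of_agree`). The set formed by `v` and its leaves is
independent in the original graph because the leaves are in the opposite remote set of `v`.

Protocols are not written down explicitly: `CanReach Good ψ` says that some protocol leads
from `ψ` to states with property `Good` only, and it is proved backwards, one operation at a time.
-/

namespace RemoteGHZ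

open Finset

/-! ### Reachability by local protocols -/

section Reach

variable {V : Type*} [DecidableEq V] {Good : QState V → Prop}

/-- Some protocol turns `ψ` into a state with property `Good`, whatever the measurement outcomes. -/
def CanReach (Good : QState V → Prop) (ψ : QState V) : Prop :=
  ∃ p : LocalProtocol V, ∀ χ ∈ p.outputs ψ, Good χ

theorem CanReach.of_good {ψ : QState V} (h : Good ψ) : CanReach Good ψ :=
  ⟨.halt, by rintro χ rfl; exact h⟩

theorem CanReach.of_clifford {ψ : QState V} (v : V) (U : Matrix (Fin 2) (Fin 2) ℂ)
    (hU : IsClifford U) (h : CanReach Good (applyAt v U ψ)) : CanReach Good ψ := by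
  obtain ⟨p, hp⟩ := h
  exact ⟨.clifford v U hU p, hp⟩

theorem CanReach.of_measure {ψ : QState V} (v : V) (P : Pauli)
    (h : ∀ s, CanReach Good (applyAt v (P.proj s) ψ)) : CanReach Good ψ := by
  choose p hp using h
  refine ⟨.measure v P p, ?_⟩
  rintro χ ⟨s, -, hχ⟩
  exact hp s χ hχ

theorem isClifford_Z : IsClifford Pauli.Z.toMatrix := by
  refine ⟨?_, fun P => ⟨P, ?_⟩⟩
  · rw [Matrix.mem_unitaryGroup_iff]
    ext i j
    fin_cases i <;> fin_cases j <;> simp [Pauli.toMatrix, Matrix.mul_apply, Matrix.star_apply]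
  · cases P
    · right
      ext i j
      fin_cases i <;> fin_cases j <;> simp [Pauli.toMatrix, Matrix.mul_apply]
    · right
      ext i j
      fin_cases i <;> fin_cases j <;> simp [Pauli.toMatrix, Matrix.mul_apply]
    · left
      ext i j
      fin_cases i <;> fin_cases j <;> simp [Pauli.toMatrix, Matrix.mul_apply]

/-- The Hadamard gate. -/
noncomputable def hadamard : Matrix (Fin 2) (Fin 2) ℂ :=
  ((1 / √2 : ℝ) : ℂ) • !![1, 1; 1, -1]

theorem inv_sqrt_two_mul_self : ((1 / √2 : ℝ) : ℂ) * ((1 / √2 : ℝ) : ℂ) = 1 / 2 := by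
  rw [← Complex.ofReal_mul, div_mul_div_comm, Real.mul_self_sqrt (by norm_num)]
  norm_num

theorem inv_sqrt_two_ne_zero : ((1 / √2 : ℝ) : ℂ) ≠ 0 := by
  intro h
  have := inv_sqrt_two_mul_self
  rw [h] at this
  norm_num at this

theorem hadamard_conj (A : Matrix (Fin 2) (Fin 2) ℂ) :
    hadamard * A * hadamard.conjTranspose =
      (1 / 2 : ℂ) • (!![1, 1; 1, -1] * A * !![1, 1; 1, -1]) := by
  have h : hadamard.conjTranspose = hadamard := by
    ext i j
    fin_cases i <;> fin_cases j <;> simp [hadamard, Matrix.conjTranspose_apply]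
  rw [h, hadamard, Matrix.smul_mul, Matrix.smul_mul, Matrix.mul_smul, smul_smul,
    inv_sqrt_two_mul_self]

theorem isClifford_hadamard : IsClifford hadamard := by
  constructor
  · rw [Matrix.mem_unitaryGroup_iff, Matrix.star_eq_conjTranspose, ← mul_one hadamard,
      Matrix.conjTranspose_mul, Matrix.conjTranspose_one, one_mul, hadamard_conj]
    ext i j
    fin_cases i <;> fin_cases j <;> norm_num [Matrix.mul_apply]
  · intro P
    simp only [hadamard_conj]
    cases P
    · refine ⟨.Z, Or.inl ?_⟩
      ext i j
      fin_cases i <;> fin_cases j <;> norm_num [Pauli.toMatrix, Matrix.mul_apply]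
    · refine ⟨.Y, Or.inr ?_⟩
      ext i j
      fin_cases i <;> fin_cases j <;> simp [Pauli.toMatrix] <;> ring
    · refine ⟨.X, Or.inl ?_⟩
      ext i j
      fin_cases i <;> fin_cases j <;> norm_num [Pauli.toMatrix, Matrix.mul_apply]

/-- A phase `Z ^ k` on a single qubit can be undone. -/
theorem CanReach.phase {ψ : QState V} (u : V) (k : ℕ) (h : CanReach Good ψ) :
    CanReach Good (fun x => (-1) ^ (k * (x u : ℕ)) * ψ x) := by
  rcases Nat.even_or_odd k with hk | hk
  · simpa [pow_mul, hk.neg_one_pow] using h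
  · refine .of_clifford u _ isClifford_Z ?_
    convert h using 1
    ext x
    obtain hx | hx : x u = 0 ∨ x u = 1 := by omega
    · have : Function.update x u 0 = x := by rw [← hx, Function.update_eq_self]
      simp [applyAt, Pauli.toMatrix, pow_mul, hk.neg_one_pow, hx, this]
    · have : Function.update x u 1 = x := by rw [← hx, Function.update_eq_self]
      simp [applyAt, Pauli.toMatrix, pow_mul, hk.neg_one_pow, hx, this]

theorem CanReach.prod_phase {ψ : QState V} (U : Finset V) (l : V → ℕ) (h : CanReach Good ψ) :
    CanReach Good (fun x => (∏ u ∈ U, (-1) ^ (l u * (x u : ℕ))) * ψ x) := by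
  induction U using Finset.induction_on with
  | empty => simpa using h
  | insert u U hu ih =>
    convert ih.phase u (l u) using 2 with x
    rw [Finset.prod_insert hu, mul_assoc]

theorem applyAt_proj_Z (v : V) (s : Fin 2) (ψ : QState V) :
    applyAt v (Pauli.Z.proj s) ψ = fun x => if x v = s then ψ x else 0 := by
  ext x
  obtain hx | hx : x v = 0 ∨ x v = 1 := by omega
  · have : Function.update x v 0 = x := by rw [← hx, Function.update_eq_self]
    fin_cases s <;> norm_num [applyAt, Pauli.proj, Pauli.toMatrix, hx, this]
  · have : Function.update x v 1 = x := by rw [← hx, Function.update_eq_self]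
    fin_cases s <;> norm_num [applyAt, Pauli.proj, Pauli.toMatrix, hx, this]

/-- Measuring `Z` on every qubit of `M` pins these qubits to the outcomes `m`. -/
theorem CanReach.of_measure_Z (M : Finset V) {ψ : QState V}
    (h : ∀ m : V → Fin 2, CanReach Good fun x => if ∀ u ∈ M, x u = m u then ψ x else 0) :
    CanReach Good ψ := by
  induction M using Finset.induction_on generalizing ψ with
  | empty => simpa using h
  | insert w M hw ih =>
    refine .of_measure w .Z fun s => ih fun m => ?_
    convert h (Function.update m w s) using 2 with x
    have hM : (∀ u ∈ M, x u = Function.update m w s u) ↔ ∀ u ∈ M, x u = m u :=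
      forall₂_congr fun u hu => by
        rw [Function.update_of_ne (by rintro rfl; exact hw hu)]
    simp only [applyAt_proj_Z, Finset.forall_mem_insert, Function.update_self, hM]
    by_cases h1 : x w = s <;> by_cases h2 : ∀ u ∈ M, x u = m u <;> simp only [h1, h2] <;> simp

/-- A Hadamard gate on each leaf `t ∈ T` replaces the controlled-`Z` phase between `t` and its
centre `c t` by the condition that the two qubits agree. -/
theorem CanReach.of_hadamard (T : Finset V) (c : V → V) (hc : ∀ t ∈ T, c t ∉ T) {Φ : QState V}
    (hΦ : ∀ t ∈ T, ∀ x b, Φ (Function.update x t b) = Φ x)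
    (h : CanReach Good fun x =>
      Φ x * ∏ t ∈ T, 2 * ((1 / √2 : ℝ) : ℂ) * if x (c t) = x t then 1 else 0) :
    CanReach Good fun x => Φ x * ∏ t ∈ T, (-1) ^ ((x (c t) : ℕ) * (x t : ℕ)) := by
  induction T using Finset.induction_on generalizing Φ with
  | empty => simpa using h
  | insert t T ht ih =>
    have hct : c t ≠ t := fun e => hc t (mem_insert_self t T) (by rw [e]; exact mem_insert_self t T)
    have hcT : ∀ t' ∈ T, c t' ≠ t := fun t' ht' e =>
      hc t' (mem_insert_of_mem ht') (by rw [e]; exact mem_insert_self t T)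
    refine .of_clifford t _ isClifford_hadamard ?_
    convert ih (Φ := fun x => Φ x * (2 * ((1 / √2 : ℝ) : ℂ) * if x (c t) = x t then 1 else 0))
      (fun t' ht' hmem => hc t' (mem_insert_of_mem ht') (mem_insert_of_mem hmem)) ?_ ?_ using 1
    · ext x
      have hprod : ∀ b, ∏ t' ∈ T, (-1 : ℂ) ^ ((Function.update x t b (c t') : ℕ) *
          (Function.update x t b t' : ℕ)) = ∏ t' ∈ T, (-1) ^ ((x (c t') : ℕ) * (x t' : ℕ)) :=
        fun b => prod_congr rfl fun t' ht' => by
          rw [Function.update_of_ne (hcT t' ht'),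
            Function.update_of_ne (ne_of_mem_of_not_mem ht' ht)]
      simp only [applyAt, Fin.sum_univ_two, hΦ t (mem_insert_self t T), prod_insert ht, hprod,
        Function.update_of_ne hct, Function.update_self]
      obtain hx | hx : x t = 0 ∨ x t = 1 := by omega
      all_goals
        obtain hy | hy : x (c t) = 0 ∨ x (c t) = 1 := by omega
        all_goals
          simp [hadamard, hx, hy]
          try ring
    · intro t' ht' x b
      simp only [hΦ t' (mem_insert_of_mem ht')]
      have hct' : c t ≠ t' := fun e =>
        hc t (mem_insert_self t T) (by rw [e]; exact mem_insert_of_mem ht')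
      rw [Function.update_of_ne (ne_of_mem_of_not_mem ht' ht).symm, Function.update_of_ne hct']
    · convert h using 2 with x
      rw [prod_insert ht, mul_assoc]

end Reach

/-! ### Two-colorable graph states and the pivot on two star vertices -/

section Pivot

variable {V : Type*} [Fintype V] [DecidableEq V] {G : SimpleGraph V} [DecidableRel G.Adj]

theorem prod_edgeFinset_eq (C : G.Coloring (Fin 2)) (i : Fin 2) (x : V → Fin 2) :
    (∏ e ∈ G.edgeFinset, if ∀ v ∈ e, x v = 1 then (-1 : ℂ) else 1) =
      ∏ u ∈ part C i, ∏ w ∈ (part C i)ᶜ,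
        if G.Adj u w then (-1) ^ ((x u : ℕ) * (x w : ℕ)) else 1 := by
  conv_rhs => rw [← prod_product', ← prod_filter]
  symm
  refine prod_bij (fun p _ => s(p.1, p.2)) ?_ ?_ ?_ ?_
  · intro p hp
    simp only [mem_filter] at hp
    simpa using hp.2
  · rintro ⟨u, w⟩ hp ⟨u', w'⟩ hp' h
    simp only [part, mem_filter, mem_product, mem_compl, mem_univ, true_and] at hp hp'
    rcases Sym2.eq_iff.mp h with ⟨h1, h2⟩ | ⟨h1, h2⟩
    · exact Prod.ext h1 h2
    · exact absurd ((congrArg C h1).symm.trans hp.1.1) hp'.1.2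
  · intro e he
    induction e using Sym2.ind with
    | _ u w =>
      have hadj : G.Adj u w := by simpa using he
      have hne := C.valid hadj
      by_cases hu : C u = i
      · refine ⟨(u, w), ?_, rfl⟩
        simp only [part, mem_filter, mem_product, mem_compl, mem_univ, true_and]
        exact ⟨⟨hu, fun hw => hne (hu.trans hw.symm)⟩, hadj⟩
      · refine ⟨(w, u), ?_, Sym2.eq_swap⟩
        simp only [part, mem_filter, mem_product, mem_compl, mem_univ, true_and]
        exact ⟨⟨by omega, hu⟩, hadj.symm⟩
  · rintro ⟨u, w⟩ -
    simp only [Sym2.mem_iff, forall_eq_or_imp, forall_eq]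
    obtain hu | hu : x u = 0 ∨ x u = 1 := by omega
    all_goals
      obtain hw | hw : x w = 0 ∨ x w = 1 := by omega
      all_goals simp [hu, hw]

theorem proj_X_apply (s p q : Fin 2) :
    Pauli.X.proj s p q = (1 / 2) * (-1) ^ ((s : ℕ) * ((p : ℕ) + (q : ℕ))) := by
  fin_cases s <;> fin_cases p <;> fin_cases q <;> norm_num [Pauli.proj, Pauli.toMatrix]

/-- The Gauss sum behind the pivot: summing out two adjacent qubits that are linked to parities
`D` and `A` leaves the product phase `(-1) ^ ((s + D) * (t + A))`. -/
theorem pivot_sum (s t p q : Fin 2) (A D R N : ℕ) (hN : R + N = A * D) (c : ℂ) :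
    ∑ β : Fin 2, (1 / 2) * (-1) ^ ((t : ℕ) * ((q : ℕ) + (β : ℕ))) *
      ∑ α : Fin 2, (1 / 2) * (-1) ^ ((s : ℕ) * ((p : ℕ) + (α : ℕ))) *
        (c * (-1) ^ ((α : ℕ) * (β : ℕ) + (α : ℕ) * D + (β : ℕ) * A + R)) =
    c * (1 / 2) * (-1) ^ ((s : ℕ) * (t : ℕ)) *
      ((-1) ^ ((s : ℕ) * ((p : ℕ) + A)) * (-1) ^ ((t : ℕ) * ((q : ℕ) + D))) * (-1) ^ N := by
  have hR : (-1 : ℂ) ^ R = (-1) ^ (A * D) * (-1) ^ N := by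
    rw [← pow_add, ← hN, show R + N + N = R + 2 * N by ring, pow_add, pow_mul]
    norm_num
  have hAD : (-1 : ℂ) ^ (A * D) = ((-1) ^ A) ^ D := pow_mul _ _ _
  simp only [Fin.sum_univ_two, pow_add, hR, hAD, mul_add]
  rcases Nat.even_or_odd A with hA | hA <;> rcases Nat.even_or_odd D with hD | hD <;>
    fin_cases s <;> fin_cases t <;>
    simp [hA.neg_one_pow, hD.neg_one_pow] <;> ring

/-- Measuring `X` on two star vertices `a`, `b`, one in each partition, turns the graph state into
that of the bipartite complement of the graph, up to a scalar and single-qubit `Z` phases. -/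
theorem pivot_graphState (C : G.Coloring (Fin 2)) (i : Fin 2) {a b : V}
    (ha : C a = i) (hb : C b ≠ i) (haN : ∀ w, C w ≠ i → G.Adj a w)
    (hbN : ∀ u, C u = i → G.Adj u b) (s t : Fin 2) :
    ∃ c : ℂ, c ≠ 0 ∧
      applyAt b (Pauli.X.proj t) (applyAt a (Pauli.X.proj s) (graphState G)) = fun x =>
        (∏ u, (-1) ^ ((if C u = i then (s : ℕ) else (t : ℕ)) * (x u : ℕ))) *
          (c * ∏ u ∈ part C i, ∏ w ∈ (part C i)ᶜ,
            if G.Adj u w then 1 else (-1) ^ ((x u : ℕ) * (x w : ℕ))) := by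
  have hab : a ≠ b := by rintro rfl; exact hb ha
  -- The neighbours of `a` are `b` and all of `Q`, those of `b` are `a` and all of `P`, so the
  -- measured qubits couple to the others only through the parities of `x` on `Q` and on `P`.
  set P := (part C i).erase a with hPdef
  set Q := ((part C i)ᶜ).erase b with hQdef
  have hP : part C i = insert a P := (insert_erase (by simp [part, ha])).symm
  have hQ : (part C i)ᶜ = insert b Q := (insert_erase (by simp [part, hb])).symm
  have haP : a ∉ P := notMem_erase _ _
  have hbQ : b ∉ Q := notMem_erase _ _
  have hPi : ∀ u ∈ P, C u = i := fun u hu => by simpa [part] using mem_of_mem_erase hu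
  have hQi : ∀ w ∈ Q, C w ≠ i := fun w hw => by simpa [part] using mem_of_mem_erase hw
  have hPa : ∀ u ∈ P, u ≠ a := fun u hu => ne_of_mem_erase hu
  have hPb : ∀ u ∈ P, u ≠ b := by rintro u hu rfl; exact hb (hPi _ hu)
  have hQb : ∀ w ∈ Q, w ≠ b := fun w hw => ne_of_mem_erase hw
  have hQa : ∀ w ∈ Q, w ≠ a := by rintro w hw rfl; exact hQi _ hw ha
  have hnot_adj_part : ∀ x : V → Fin 2, (∏ u ∈ part C i, ∏ w ∈ (part C i)ᶜ,
      if G.Adj u w then (1 : ℂ) else (-1) ^ ((x u : ℕ) * (x w : ℕ))) =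
      (-1) ^ (∑ u ∈ P, ∑ w ∈ Q, if G.Adj u w then 0 else (x u : ℕ) * (x w : ℕ)) := by
    intro x
    rw [hQ, hP, prod_insert haP, prod_eq_one, one_mul, ← prod_pow_eq_pow_sum]
    · refine prod_congr rfl fun u hu => ?_
      rw [prod_insert hbQ, if_pos (hbN u (hPi u hu)), one_mul, ← prod_pow_eq_pow_sum]
      refine prod_congr rfl fun w _ => ?_
      split_ifs <;> simp
    · intro w hw
      rw [if_pos]
      rcases mem_insert.mp hw with rfl | hw
      · exact haN _ hb
      · exact haN _ (hQi w hw)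
  have hgraph : ∀ x : V → Fin 2, ∀ α β : Fin 2,
      graphState G (Function.update (Function.update x b β) a α) =
      ((1 / √2 : ℝ) : ℂ) ^ Fintype.card V * (-1) ^ ((α : ℕ) * (β : ℕ) +
        (α : ℕ) * (∑ w ∈ Q, (x w : ℕ)) + (β : ℕ) * (∑ u ∈ P, (x u : ℕ)) +
        ∑ u ∈ P, ∑ w ∈ Q, if G.Adj u w then (x u : ℕ) * (x w : ℕ) else 0) := by
    intro x α β
    set y := Function.update (Function.update x b β) a α with hy
    have hya : y a = α := by simp [hy]
    have hyb : y b = β := by simp [hy, Function.update_of_ne hab.symm]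
    have hyP : ∀ u ∈ P, y u = x u := fun u hu => by
      simp [hy, Function.update_of_ne (hPa u hu), Function.update_of_ne (hPb u hu)]
    have hyQ : ∀ w ∈ Q, y w = x w := fun w hw => by
      simp [hy, Function.update_of_ne (hQa w hw), Function.update_of_ne (hQb w hw)]
    rw [graphState, prod_edgeFinset_eq C i, hQ, hP, prod_insert haP, prod_insert hbQ,
      if_pos (haN b hb), hya, hyb, pow_add, pow_add, pow_add]
    have h1 : (∏ w ∈ Q, if G.Adj a w then (-1 : ℂ) ^ ((α : ℕ) * (y w : ℕ)) else 1) =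
        (-1) ^ ((α : ℕ) * ∑ w ∈ Q, (x w : ℕ)) := by
      rw [mul_sum, ← prod_pow_eq_pow_sum]
      exact prod_congr rfl fun w hw => by rw [if_pos (haN w (hQi w hw)), hyQ w hw]
    have h2 : (∏ u ∈ P, ∏ w ∈ insert b Q,
        if G.Adj u w then (-1 : ℂ) ^ ((y u : ℕ) * (y w : ℕ)) else 1) =
        (-1) ^ ((β : ℕ) * ∑ u ∈ P, (x u : ℕ)) *
        (-1) ^ (∑ u ∈ P, ∑ w ∈ Q, if G.Adj u w then (x u : ℕ) * (x w : ℕ) else 0) := by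
      rw [mul_sum, ← prod_pow_eq_pow_sum, ← prod_pow_eq_pow_sum, ← prod_mul_distrib]
      refine prod_congr rfl fun u hu => ?_
      rw [prod_insert hbQ, if_pos (hbN u (hPi u hu)), hyb, hyP u hu, mul_comm (β : ℕ),
        ← prod_pow_eq_pow_sum]
      congr 1
      refine prod_congr rfl fun w hw => ?_
      rw [hyQ w hw]
      split_ifs <;> simp
    rw [h1, h2]
    ring
  have hsum : ∀ x : V → Fin 2,
      (∑ u ∈ P, ∑ w ∈ Q, if G.Adj u w then (x u : ℕ) * (x w : ℕ) else 0) +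
      (∑ u ∈ P, ∑ w ∈ Q, if G.Adj u w then 0 else (x u : ℕ) * (x w : ℕ)) =
      (∑ u ∈ P, (x u : ℕ)) * ∑ w ∈ Q, (x w : ℕ) := by
    intro x
    rw [sum_mul_sum, ← sum_add_distrib]
    refine sum_congr rfl fun u _ => ?_
    rw [← sum_add_distrib]
    refine sum_congr rfl fun w _ => ?_
    split_ifs <;> simp
  have hphase : ∀ x : V → Fin 2,
      (∏ u, (-1 : ℂ) ^ ((if C u = i then (s : ℕ) else (t : ℕ)) * (x u : ℕ))) =
      (-1) ^ ((s : ℕ) * ((x a : ℕ) + ∑ u ∈ P, (x u : ℕ))) *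
      (-1) ^ ((t : ℕ) * ((x b : ℕ) + ∑ w ∈ Q, (x w : ℕ))) := by
    intro x
    rw [← prod_mul_prod_compl (part C i), hQ, hP,
      ← sum_insert (f := fun u => (x u : ℕ)) haP, ← sum_insert (f := fun u => (x u : ℕ)) hbQ,
      mul_sum, mul_sum, ← prod_pow_eq_pow_sum, ← prod_pow_eq_pow_sum]
    congr 1
    · refine prod_congr rfl fun u hu => ?_
      rw [← hP] at hu
      rw [if_pos (by simpa [part] using hu)]
    · refine prod_congr rfl fun u hu => ?_
      rw [← hQ] at hu
      rw [if_neg (by simpa [part] using hu)]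
  refine ⟨((1 / √2 : ℝ) : ℂ) ^ Fintype.card V * (1 / 2) * (-1) ^ ((s : ℕ) * (t : ℕ)), ?_, ?_⟩
  · exact mul_ne_zero (mul_ne_zero (pow_ne_zero _ inv_sqrt_two_ne_zero) (by norm_num))
      (pow_ne_zero _ (by norm_num))
  · ext x
    simp only [applyAt, hnot_adj_part, hphase, hgraph, proj_X_apply, Function.update_of_ne hab]
    rw [pivot_sum s t (x a) (x b) _ _ _ _ (hsum x)]
    ring

end Pivot

/-! ### Phases absorbed by pinned qubits -/

section Phase

variable {V : Type*} [Fintype V]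

/-- On the basis states in `X`, the functions `F` and `F'` differ by a nonzero scalar and
single-qubit `Z` phases. -/
def PhaseEquiv (X : Set (V → Fin 2)) (F F' : QState V) : Prop :=
  ∃ c : ℂ, c ≠ 0 ∧ ∃ l : V → ℕ, ∀ x ∈ X, F x = (∏ u, (-1) ^ (l u * (x u : ℕ))) * (c * F' x)

theorem PhaseEquiv.of_eqOn {X : Set (V → Fin 2)} {F F' : QState V} (h : ∀ x ∈ X, F x = F' x) :
    PhaseEquiv X F F' :=
  ⟨1, one_ne_zero, 0, fun x hx => by simp [h x hx]⟩

theorem PhaseEquiv.of_linear [DecidableEq V] {X : Set (V → Fin 2)} {F : QState V} (v : V) (k : ℕ)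
    (h : ∀ x ∈ X, F x = (-1) ^ (k * (x v : ℕ))) : PhaseEquiv X F fun _ => 1 := by
  refine ⟨1, one_ne_zero, Pi.single v k, fun x hx => ?_⟩
  rw [h x hx, prod_eq_single v]
  · simp
  · intro u _ hu
    simp [Pi.single_eq_of_ne hu]
  · simp

theorem PhaseEquiv.prod {ι : Type*} {X : Set (V → Fin 2)} (I : Finset ι) {F F' : ι → QState V}
    (h : ∀ j ∈ I, PhaseEquiv X (F j) (F' j)) :
    PhaseEquiv X (fun x => ∏ j ∈ I, F j x) (fun x => ∏ j ∈ I, F' j x) := by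
  classical
  induction I using Finset.induction_on with
  | empty => exact .of_eqOn (by simp)
  | insert j I hj ih =>
    obtain ⟨c, hc, l, hl⟩ := h j (mem_insert_self j I)
    obtain ⟨c', hc', l', hl'⟩ := ih fun k hk => h k (mem_insert_of_mem hk)
    refine ⟨c * c', mul_ne_zero hc hc', l + l', fun x hx => ?_⟩
    simp only [prod_insert hj, hl x hx, hl' x hx, Pi.add_apply, add_mul, pow_add,
      prod_mul_distrib]
    ring

end Phase

/-! ### Extraction of the GHZ states -/

/-- A product of star-shaped agreement conditions is a product of GHZ states. -/
theorem isGHZProduct_of_agree {V : Type*} [Fintype V] [DecidableEq V] {r : ℕ} (z : Fin r → V)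
    (L : Fin r → Finset V) (M : Finset V) (m : V → Fin 2)
    (hM : ∀ u, u ∈ M ↔ ∀ k, u ∉ insert (z k) (L k)) {c : ℂ} (hc : c ≠ 0) :
    IsGHZProduct (fun k => insert (z k) (L k)) fun x =>
      (if ∀ u ∈ M, x u = m u then c else 0) * ∏ k, ∏ t ∈ L k, if x (z k) = x t then 1 else 0 := by
  have hg : ∀ (k : Fin r) (x : V → Fin 2),
      (ghzState (insert (z k) (L k) : Finset V) fun v => x v) =
        ((1 / √2 : ℝ) : ℂ) * ∏ t ∈ L k, if x (z k) = x t then 1 else 0 := by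
    intro k x
    rw [prod_ite_zero, prod_const_one, ghzState]
    congr 1
    simp only [Subtype.forall, forall_mem_insert]
    obtain hz | hz : x (z k) = 0 ∨ x (z k) = 1 := by omega
    all_goals simp [hz, eq_comm]
  classical
  refine ⟨fun y => ((1 / √2 : ℝ) : ℂ)⁻¹ ^ r * if ∀ u, y u = m u then c else 0, ?_, ?_⟩
  · intro h
    have := congrFun h fun u => m u
    simp [hc] at this
  · intro x
    have hsupp : (∀ u : {v : V // ∀ k, v ∉ insert (z k) (L k)}, x u = m u) ↔
        ∀ u ∈ M, x u = m u := by
      simp only [Subtype.forall, hM]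
    have h1 : ((1 / √2 : ℝ) : ℂ) ^ r * ((1 / √2 : ℝ) : ℂ)⁻¹ ^ r = 1 := by
      rw [← mul_pow, mul_inv_cancel₀ inv_sqrt_two_ne_zero, one_pow]
    simp only [hg, prod_mul_distrib, prod_const, card_univ, Fintype.card_fin]
    by_cases hx : ∀ u ∈ M, x u = m u
    · rw [if_pos hx, if_pos (hsupp.2 hx)]
      linear_combination (-c * ∏ k, ∏ t ∈ L k, if x (z k) = x t then (1 : ℂ) else 0) * h1
    · rw [if_neg hx, if_neg (mt hsupp.1 hx)]
      ring

section Extraction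

variable {V : Type*} [Fintype V] [DecidableEq V] {G : SimpleGraph V} [DecidableRel G.Adj]

/-- Once all qubits other than the centres `B` and the leaves `T` are pinned, the phases of the
bipartite complement reduce to those of disjoint stars, because the only leaves not adjacent to
a given centre are its own. -/
theorem phaseEquiv_stars (C : G.Coloring (Fin 2)) (i : Fin 2) {B T : Finset V} {cen : V → V}
    (hB : ∀ v ∈ B, C v = i) (hT : ∀ t ∈ T, C t ≠ i) (hcen : ∀ t ∈ T, cen t ∈ B)
    (hnadj : ∀ t ∈ T, ¬G.Adj (cen t) t) (hadj : ∀ v ∈ B, ∀ t ∈ T, v ≠ cen t → G.Adj v t)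
    (m : V → Fin 2) :
    PhaseEquiv {x | ∀ u ∈ (B ∪ T)ᶜ, x u = m u}
      (fun x => ∏ u ∈ part C i, ∏ w ∈ (part C i)ᶜ,
        if G.Adj u w then 1 else (-1) ^ ((x u : ℕ) * (x w : ℕ)))
      (fun x => ∏ t ∈ T, (-1) ^ ((x (cen t) : ℕ) * (x t : ℕ))) := by
  have hstars : (fun x : V → Fin 2 => ∏ t ∈ T, (-1 : ℂ) ^ ((x (cen t) : ℕ) * (x t : ℕ))) =
      fun x => ∏ u ∈ part C i, ∏ w ∈ (part C i)ᶜ,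
        if w ∈ T ∧ u = cen w then (-1) ^ ((x u : ℕ) * (x w : ℕ)) else 1 := by
    ext x
    rw [prod_comm]
    have hsub : T ⊆ (part C i)ᶜ := fun t ht => by simpa [part] using hT t ht
    rw [← prod_subset hsub fun w _ hw => prod_eq_one fun u _ => if_neg fun h => hw h.1]
    refine prod_congr rfl fun t ht => ?_
    have hmem : cen t ∈ part C i := by simpa [part] using hB _ (hcen t ht)
    rw [prod_eq_single_of_mem (cen t) hmem fun u _ hu => if_neg fun h => hu h.2,
      if_pos ⟨ht, rfl⟩]
  rw [hstars]
  refine .prod _ fun u hu => .prod _ fun w hw => ?_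
  have hu' : C u = i := by simpa [part] using hu
  have hw' : C w ≠ i := by simpa [part] using hw
  by_cases hadj' : G.Adj u w
  · have hne : ¬(w ∈ T ∧ u = cen w) := by
      rintro ⟨h, rfl⟩
      exact hnadj w h hadj'
    exact .of_eqOn fun x _ => by rw [if_pos hadj', if_neg hne]
  by_cases hpair : w ∈ T ∧ u = cen w
  · exact .of_eqOn fun x _ => by rw [if_neg hadj', if_pos hpair]
  simp only [if_neg hadj', if_neg hpair]
  by_cases huB : u ∈ B
  · have hwT : w ∉ T := fun h => hadj' (hadj u huB w h fun e => hpair ⟨h, e⟩)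
    have hwM : w ∈ (B ∪ T)ᶜ := by
      simp only [mem_compl, mem_union, not_or]
      exact ⟨fun h => hw' (hB w h), hwT⟩
    exact .of_linear u (m w) fun x hx => by rw [hx w hwM, mul_comm]
  · have huM : u ∈ (B ∪ T)ᶜ := by
      simp only [mem_compl, mem_union, not_or]
      exact ⟨huB, fun h => hT u h hu'⟩
    exact .of_linear w (m u) fun x hx => by rw [hx u huM]

/-- The whole protocol: `X` measurements of the star vertices, `Z` measurements outside `B ∪ T`,
`Z` corrections, and Hadamard gates on the leaves. -/
theorem canReach_of_agree (C : G.Coloring (Fin 2)) (i : Fin 2) {a b : V}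
    (ha : C a = i) (hb : C b ≠ i) (haN : ∀ w, C w ≠ i → G.Adj a w)
    (hbN : ∀ u, C u = i → G.Adj u b) {B T : Finset V} {cen : V → V}
    (hB : ∀ v ∈ B, C v = i) (hT : ∀ t ∈ T, C t ≠ i) (hcen : ∀ t ∈ T, cen t ∈ B)
    (hnadj : ∀ t ∈ T, ¬G.Adj (cen t) t) (hadj : ∀ v ∈ B, ∀ t ∈ T, v ≠ cen t → G.Adj v t)
    {Good : QState V → Prop}
    (h : ∀ (m : V → Fin 2) (c : ℂ), c ≠ 0 → Good fun x =>
      (if ∀ u ∈ (B ∪ T)ᶜ, x u = m u then c else 0) *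
        ∏ t ∈ T, if x (cen t) = x t then 1 else 0) :
    CanReach Good (graphState G) := by
  refine .of_measure a .X fun s => .of_measure b .X fun t => ?_
  obtain ⟨c, hc, hpivot⟩ := pivot_graphState C i ha hb haN hbN s t
  rw [hpivot]
  refine .prod_phase univ (fun u => if C u = i then (s : ℕ) else (t : ℕ)) ?_
  -- Re-measuring `a` and `b`, where they lie in `(B ∪ T)ᶜ`, is harmless.
  refine .of_measure_Z (B ∪ T)ᶜ fun m => ?_
  obtain ⟨c', hc', l, hl⟩ := phaseEquiv_stars C i hB hT hcen hnadj hadj m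
  have hstate := CanReach.prod_phase (Good := Good) univ l
    (ψ := fun x => (if ∀ u ∈ (B ∪ T)ᶜ, x u = m u then c * c' else 0) *
      ∏ t ∈ T, (-1) ^ ((x (cen t) : ℕ) * (x t : ℕ))) ?_
  · convert hstate using 2 with x
    by_cases hx : ∀ u ∈ (B ∪ T)ᶜ, x u = m u
    · have hlx := hl x hx
      simp only at hlx
      rw [if_pos hx, if_pos hx, hlx]
      ring
    · rw [if_neg hx, if_neg hx]
      ring
  refine .of_hadamard T cen (fun t ht h => hT _ h (hB _ (hcen t ht))) ?_ ?_
  · intro t ht x b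
    have hiff : (∀ u ∈ (B ∪ T)ᶜ, Function.update x t b u = m u) ↔
        ∀ u ∈ (B ∪ T)ᶜ, x u = m u := by
      refine forall₂_congr fun u hu => ?_
      have hut : u ≠ t := by
        rintro rfl
        exact mem_compl.mp hu (mem_union_right _ ht)
      rw [Function.update_of_ne hut]
    simp only [hiff]
  · have hk : c * c' * (2 * ((1 / √2 : ℝ) : ℂ)) ^ T.card ≠ 0 :=
      mul_ne_zero (mul_ne_zero hc hc')
        (pow_ne_zero _ (mul_ne_zero two_ne_zero inv_sqrt_two_ne_zero))
    refine .of_good ?_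
    convert h m _ hk using 2 with x
    rw [prod_mul_distrib, prod_const]
    split_ifs <;> ring

end Extraction

end RemoteGHZ

open RemoteGHZ Finset in
theorem lemma2 {V : Type*} [Fintype V] [DecidableEq V] (G : SimpleGraph V) [DecidableRel G.Adj]
    (C : G.Coloring (Fin 2))
    (hstar : ∀ j : Fin 2, (RemoteGHZ.starVertices C j).Nonempty)
    (n : ℕ) (hn : 1 ≤ n) (i : Fin 2) (B : Finset V)
    (hB : B ⊆ RemoteGHZ.nonStarVertices C i)
    (hcard : ∀ v ∈ B,
      n - 1 ≤ (RemoteGHZ.oppRemote C v \ RemoteGHZ.commonOppRemote C B).card)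
    (hdisj : ∀ v ∈ B, ∀ w ∈ B, v ≠ w →
      Disjoint (RemoteGHZ.oppRemote C v \ RemoteGHZ.commonOppRemote C B)
        (RemoteGHZ.oppRemote C w \ RemoteGHZ.commonOppRemote C B)) :
    RemoteGHZ.RemoteExtractable G n B.card := by
  obtain ⟨a, ha⟩ := hstar i
  obtain ⟨b, hb⟩ := hstar (1 - i)
  rw [starVertices, mem_filter] at ha hb
  simp only [part, mem_filter, mem_univ, true_and] at ha hb
  obtain ⟨ha, haN⟩ := ha
  obtain ⟨hb, hbN⟩ := hb
  have haN : ∀ w, C w ≠ i → G.Adj a w := fun w hw => by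
    rw [← SimpleGraph.mem_neighborFinset, haN]
    simpa using hw
  have hbN : ∀ u, C u = i → G.Adj u b := fun u hu => by
    rw [SimpleGraph.adj_comm, ← SimpleGraph.mem_neighborFinset, hbN]
    simp only [mem_compl, mem_filter, mem_univ, true_and, hu]
    omega
  have hBi : ∀ v ∈ B, C v = i := fun v hv => by
    have := hB hv
    simp only [nonStarVertices, part, mem_sdiff, mem_filter, mem_univ, true_and] at this
    exact this.1
  choose! L hLsub hLcard using fun v hv => exists_subset_card_eq (hcard v hv)
  have hL : ∀ v ∈ B, ∀ t ∈ L v, C t ≠ i ∧ ¬G.Adj v t := fun v hv t ht => by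
    have := hLsub v hv ht
    simp only [oppRemote, mem_sdiff, mem_filter, mem_univ, true_and, hBi v hv] at this
    exact this.1
  -- A leaf of `w` is not in the remote set of any other centre `v`, as it would lie in the
  -- private parts of both.
  have hcross : ∀ v ∈ B, ∀ w ∈ B, v ≠ w → ∀ t ∈ L w, G.Adj v t := by
    intro v hv w hw hvw t ht
    by_contra hvt
    have htw := hLsub w hw ht
    refine disjoint_left.mp (hdisj v hv w hw hvw) (mem_sdiff.mpr ⟨?_, (mem_sdiff.mp htw).2⟩) htw
    simp only [oppRemote, mem_filter, mem_univ, true_and, hBi v hv]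
    exact ⟨(hL w hw t ht).1, hvt⟩
  have huniq : ∀ v ∈ B, ∀ w ∈ B, ∀ t, t ∈ L v → t ∈ L w → v = w := by
    intro v hv w hw t htv htw
    by_contra hvw
    exact (hL v hv t htv).2 (hcross v hv w hw hvw t htw)
  choose! cen hcenB hcenL using fun t (ht : t ∈ B.biUnion L) => mem_biUnion.mp ht
  have hcen : ∀ v ∈ B, ∀ t ∈ L v, cen t = v := fun v hv t ht =>
    have htT := mem_biUnion.mpr ⟨v, hv, ht⟩
    huniq _ (hcenB t htT) v hv t (hcenL t htT) ht
  have hBL : ∀ v ∈ B, ∀ w ∈ B, v ∉ L w := fun v hv w hw h => (hL w hw v h).1 (hBi v hv)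
  let e := B.equivFin.symm
  have heB : ∀ k, (e k : V) ∈ B := fun k => (e k).2
  refine ⟨fun k => insert (e k : V) (L (e k)), fun k => ?_, fun k => ?_, fun k l hkl => ?_, ?_⟩
  · rw [card_insert_of_notMem (hBL _ (heB k) _ (heB k)), hLcard _ (heB k)]
    omega
  · intro u hu w hw _ hadj
    simp only [coe_insert, Set.mem_insert_iff, mem_coe] at hu hw
    rcases hu with rfl | hu <;> rcases hw with rfl | hw
    · exact hadj.ne rfl
    · exact (hL _ (heB k) w hw).2 hadj
    · exact (hL _ (heB k) u hu).2 hadj.symm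
    · have := C.valid hadj
      have h1 := (hL _ (heB k) u hu).1
      have h2 := (hL _ (heB k) w hw).1
      omega
  · have hne : (e k : V) ≠ e l := fun h => hkl (e.injective (Subtype.ext h))
    rw [disjoint_left]
    intro u hu hu'
    rcases mem_insert.mp hu with rfl | hu <;> rcases mem_insert.mp hu' with h | hu'
    · exact hne h
    · exact hBL _ (heB k) _ (heB l) hu'
    · exact hBL _ (heB l) _ (heB k) (h ▸ hu)
    · exact hne (huniq _ (heB k) _ (heB l) u hu hu')
  · refine canReach_of_agree C i ha (by omega) haN hbN hBi (T := B.biUnion L) (cen := cen)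
      ?_ hcenB ?_ ?_ fun m c hc => ?_
    · intro t ht
      exact (hL _ (hcenB t ht) t (hcenL t ht)).1
    · intro t ht
      exact (hL _ (hcenB t ht) t (hcenL t ht)).2
    · intro v hv t ht hne
      exact hcross v hv _ (hcenB t ht) hne t (hcenL t ht)
    · convert isGHZProduct_of_agree (fun k => (e k : V)) (fun k => L (e k)) (B ∪ B.biUnion L)ᶜ m
        ?_ hc using 3 with x
      · rw [prod_biUnion fun v hv w hw hvw =>
          disjoint_left.mpr fun t htv htw => hvw (huniq v hv w hw t htv htw), ← prod_coe_sort B,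
          ← e.prod_comp]
        exact prod_congr rfl fun k _ => prod_congr rfl fun t ht => by
          rw [hcen _ (heB k) t ht]
      · intro u
        simp only [mem_compl, mem_union, mem_biUnion, mem_insert, not_or, not_exists, not_and]
        constructor
        · exact fun h k => ⟨fun hu => h.1 (hu ▸ heB k), h.2 _ (heB k)⟩
        · refine fun h => ⟨fun hu => ?_, fun v hv hu => ?_⟩
          · exact (h (e.symm ⟨u, hu⟩)).1 (by simp)
          · exact (h (e.symm ⟨v, hv⟩)).2 (by simpa using hu)
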